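/- Let $(R,\mathfrak m,k)$ be a commutative Noetherian local ring; all $R$-modules below are finitely generated, and $(-)^*=\operatorname{Hom}_R(-,R)$. An $R$-module $G$ is *totally reflexive* if the evaluation map $G\to G^{**}$ is an isomorphism and $\operatorname{Ext}^i_R(G,R)=\operatorname{Ext}^i_R(G^*,R)=0$ for all $i>0$. The *Gorenstein dimension* $\operatorname{G-dim}_R M$ is the least length of a resolution of $M$ by totally reflexive modules ($\infty$ if there is none of finite length). A *proper resolution* of $M$ is a (possibly infinite) resolution $\mathcal T\to M$ by totally reflexive modules such that for every totally reflexive $G$ the sequence $\cdots\to\operatorname{Hom}_R(G,\mathcal T_1)\to\operatorname{Hom}_R(G,\mathcal T_0)\to\operatorname{Hom}_R(G,M)\to 0$ is exact. If $M$ has a proper resolution $\mathcal T\to M$, the *relative homology* of $M$ with an $R$-module $N$ is $\mathcal G\mathrm{Tor}_i^R(M,N)=H_i(\mathcal T\otimes_R N)$. **Proposition.** Let $M$ be an $R$-module with $\operatorname{G-dim}_R M<\infty$. Then $M$ admits a proper resolution and, whichever proper resolution is used to compute $\mathcal G\mathrm{Tor}^R_*(M,-)$, for every integer $r\ge 1$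 the following statements are equivalent: 1. $\operatorname{G-dim}_R M\le r$; 2. $\mathcal G\mathrm{Tor}_i^R(M,N)=0$ for all $i\ge r+1$ and every $R$-module $N$; 3. $\mathcal G\mathrm{Tor}_{r+1}^R(M,N)=0$ for every $R$-module $N$; 4. $\mathcal G\mathrm{Tor}_{r+1}^R(M,k)=0$. -/

import Mathlib

universe u

open CategoryTheory

/-- A finitely generated module `G` is totally reflexive if the evaluation map `G → G**` is
bijective and `Extⁱ(G, R) = Extⁱ(G*, R) = 0` for all `i > 0`, where `G* = Hom(G, R)`. -/
structure IsTotallyReflexive (R : Type u) [CommRing R] (G : Type u) [AddCommGroup G]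
    [Module R G] : Prop where
  finite : Module.Finite R G
  reflexive : Function.Bijective (Module.Dual.eval R G)
  ext_eq_zero : ∀ i : ℕ, 0 < i →
    Subsingleton (Abelian.Ext (ModuleCat.of R G) (ModuleCat.of R R) i)
  ext_dual_eq_zero : ∀ i : ℕ, 0 < i →
    Subsingleton (Abelian.Ext (ModuleCat.of R (Module.Dual R G)) (ModuleCat.of R R) i)

/-- A resolution of `M` by totally reflexive modules: a chain complex `T` of totally reflexive
modules in degrees `≥ 0` and an augmentation `ε : T₀ → M` such that
`⋯ → T₂ → T₁ → T₀ → M → 0` is exact. -/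
structure GResolution (R : Type u) [CommRing R] (M : Type u) [AddCommGroup M]
    [Module R M] where
  complex : ChainComplex (ModuleCat.{u} R) ℕ
  ε : complex.X 0 ⟶ ModuleCat.of R M
  totallyReflexive : ∀ n : ℕ, IsTotallyReflexive R (complex.X n)
  exact_succ : ∀ n : ℕ,
    Function.Exact (complex.d (n + 2) (n + 1)).hom (complex.d (n + 1) n).hom
  exact_zero : Function.Exact (complex.d 1 0).hom ε.hom
  surjective : Function.Surjective ε.hom

namespace GResolution

variable {R : Type u} [CommRing R] {M : Type u} [AddCommGroup M] [Module R M]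

/-- The resolution is of the form `0 → Tₙ → ⋯ → T₀ → M → 0`. -/
def HasLengthLE (T : GResolution R M) (n : ℕ) : Prop :=
  ∀ i : ℕ, n < i → Subsingleton (T.complex.X i)

/-- The resolution is proper: for every totally reflexive module `G`, the sequence
`⋯ → Hom(G, T₂) → Hom(G, T₁) → Hom(G, T₀) → Hom(G, M) → 0` is exact. -/
structure IsProper (T : GResolution R M) : Prop where
  exact_succ : ∀ (G : Type u) [AddCommGroup G] [Module R G], IsTotallyReflexive R G → ∀ n : ℕ,
    Function.Exact
      (fun f : G →ₗ[R] T.complex.X (n + 2) => (T.complex.d (n + 2) (n + 1)).hom ∘ₗ f)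
      (fun f : G →ₗ[R] T.complex.X (n + 1) => (T.complex.d (n + 1) n).hom ∘ₗ f)
  exact_zero : ∀ (G : Type u) [AddCommGroup G] [Module R G], IsTotallyReflexive R G →
    Function.Exact
      (fun f : G →ₗ[R] T.complex.X 1 => (T.complex.d 1 0).hom ∘ₗ f)
      (fun f : G →ₗ[R] T.complex.X 0 => (T.ε.hom ∘ₗ f : G →ₗ[R] M))
  surjective : ∀ (G : Type u) [AddCommGroup G] [Module R G], IsTotallyReflexive R G →
    Function.Surjective
      (fun f : G →ₗ[R] T.complex.X 0 => (T.ε.hom ∘ₗ f : G →ₗ[R] M))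

/-- The module `Hᵢ(T ⊗ N)`. When `T` is a proper resolution of `M`, this is the relative homology
`𝒢Torᵢ(M, N)`. -/
noncomputable def gTor (T : GResolution R M) (N : Type u) [AddCommGroup N] [Module R N]
    (i : ℕ) : ModuleCat.{u} R :=
  (((MonoidalCategory.tensorRight (ModuleCat.of R N)).mapHomologicalComplex
    (ComplexShape.down ℕ)).obj T.complex).homology i

end GResolution

/-- The Gorenstein dimension of `M`: the least length of a resolution of `M` by totally reflexive
modules, and `⊤` if there is no such resolution of finite length. -/
noncomputable def gDim (R : Type u) [CommRing R] (M : Type u) [AddCommGroup M] [Module R M] :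
    ℕ∞ :=
  ⨅ n ∈ {n : ℕ | ∃ T : GResolution R M, T.HasLengthLE n}, (n : ℕ∞)

/-! Finite Gorenstein dimension yields an Auslander–Buchweitz approximation `0 → K → X → M → 0`
(`exists_approximation`): `X` is totally reflexive, `K` has a finite free resolution, and `Ext¹(G,
K) = 0` for every totally reflexive `G`. The last property lets maps from `G` to `M` lift to `X`. It
passes to the successive cokernels that build `K` from free modules, so splicing gives a proper
resolution `P`, free in positive degrees and no longer than the given resolution
(`exists_isProper_of_hasLengthLE`).

Proper resolutions compare up to homotopy, so vanishing of relative homology can be tested on any of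
them (`subsingleton_gTor`). A short `P` gives the vanishing in statement 2. Conversely, vanishing
with coefficients `k` in degree `r + 1` says that the image of `P_{r+1} → P_r` stays embedded after
tensoring with `k`. As `P_r` is free for `r ≥ 1`, the cokernel is free over the local ring, and `P`
can be cut off there. -/

/-! ### Vanishing of `Ext(-, R)` along short exact sequences. -/

section ExtAcyclic

variable {R : Type u} [CommRing R]
variable {A B C : Type u} [AddCommGroup A] [Module R A] [AddCommGroup B] [Module R B]
  [AddCommGroup C] [Module R C]

/-- `Extⁱ(A, R) = 0` for all `i > 0`. -/
def ExtAcyclic (R : Type u) [CommRing R] (A : Type u) [AddCommGroup A] [Module R A] : Prop :=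
  ∀ i : ℕ, 0 < i → Subsingleton (Abelian.Ext (ModuleCat.of R A) (ModuleCat.of R R) i)

lemma ExtAcyclic.of_projective [Module.Projective R A] : ExtAcyclic R A := by
  intro i hi
  obtain ⟨n, rfl⟩ := Nat.exists_eq_succ_of_ne_zero hi.ne'
  exact Abelian.Ext.subsingleton_of_projective _ _ _

/-- The short complex of modules attached to an exact pair of linear maps. -/
abbrev exactShortComplex {f : A →ₗ[R] B} {g : B →ₗ[R] C} (hfg : Function.Exact f g) :
    ShortComplex (ModuleCat.{u} R) :=
  ModuleCat.shortComplexOfCompEqZero f g hfg.linearMap_comp_eq_zero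

lemma exactShortComplex_shortExact {f : A →ₗ[R] B} {g : B →ₗ[R] C} (hf : Function.Injective f)
    (hfg : Function.Exact f g) (hg : Function.Surjective g) :
    (exactShortComplex hfg).ShortExact :=
  ModuleCat.shortComplex_shortExact _ hfg hf hg

variable {f : A →ₗ[R] B} {g : B →ₗ[R] C}

lemma ExtAcyclic.of_extension (hf : Function.Injective f) (hfg : Function.Exact f g)
    (hg : Function.Surjective g) (hA : ExtAcyclic R A) (hC : ExtAcyclic R C) :
    ExtAcyclic R B := by
  intro i hi
  have : Subsingleton (Abelian.Ext (exactShortComplex hfg).X₁ (ModuleCat.of R R) i) := hA i hi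
  have : Subsingleton (Abelian.Ext (exactShortComplex hfg).X₃ (ModuleCat.of R R) i) := hC i hi
  refine subsingleton_of_forall_eq 0 fun x => ?_
  obtain ⟨y, rfl⟩ := Abelian.Ext.contravariant_sequence_exact₂
    (exactShortComplex_shortExact hf hfg hg) (ModuleCat.of R R) x (Subsingleton.elim _ _)
  rw [Subsingleton.elim y 0, Abelian.Ext.comp_zero]

lemma ExtAcyclic.of_kernel (hf : Function.Injective f) (hfg : Function.Exact f g)
    (hg : Function.Surjective g) (hB : ExtAcyclic R B) (hC : ExtAcyclic R C) :
    ExtAcyclic R A := by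
  intro i hi
  have := hB i hi
  refine subsingleton_of_forall_eq 0 fun x => ?_
  obtain ⟨y, rfl⟩ := Abelian.Ext.contravariant_sequence_exact₁
    (exactShortComplex_shortExact hf hfg hg) (ModuleCat.of R R) x rfl
    ((hC (1 + i) (by omega)).elim _ _)
  rw [Subsingleton.elim y 0, Abelian.Ext.comp_zero]

lemma ExtAcyclic.of_cokernel (hf : Function.Injective f) (hfg : Function.Exact f g)
    (hg : Function.Surjective g) (hA : ExtAcyclic R A) (hB : ExtAcyclic R B)
    (h : Function.Surjective f.dualMap) :
    ExtAcyclic R C := by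
  intro i hi
  obtain ⟨j, rfl⟩ := Nat.exists_eq_add_of_le hi
  refine subsingleton_of_forall_eq 0 fun x => ?_
  have hS := exactShortComplex_shortExact hf hfg hg
  obtain ⟨y, rfl⟩ := Abelian.Ext.contravariant_sequence_exact₃ hS (ModuleCat.of R R) x
    ((hB _ hi).elim _ _) (n₀ := j) (by omega)
  -- For `j = 0` the class in `Ext¹(C, R)` is the connecting image of a map `A → R`; that map
  -- extends to `B`, so its image is zero.
  rcases Nat.eq_zero_or_pos j with rfl | hj
  · obtain ⟨φ, rfl⟩ := (Abelian.Ext.mk₀_bijective _ _).2 y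
    obtain ⟨ψ, hψ⟩ := h φ.hom
    have : φ = (exactShortComplex hfg).f ≫ ModuleCat.ofHom ψ := by
      ext a
      exact (LinearMap.congr_fun hψ a).symm
    rw [this, ← Abelian.Ext.mk₀_comp_mk₀, hS.extClass_comp_assoc]
  · rw [(hA j hj).elim y 0, Abelian.Ext.comp_zero]

/-- The obstruction to extending a functional from `A` to `B` lies in `Ext¹(C, R) = 0`. -/
lemma ExtAcyclic.dualMap_surjective (hf : Function.Injective f) (hfg : Function.Exact f g)
    (hg : Function.Surjective g) (hC : ExtAcyclic R C) : Function.Surjective f.dualMap := by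
  intro φ
  obtain ⟨y, hy⟩ := Abelian.Ext.contravariant_sequence_exact₁
    (exactShortComplex_shortExact hf hfg hg) (ModuleCat.of R R)
    (Abelian.Ext.mk₀ (ModuleCat.ofHom φ)) rfl ((hC _ (by omega)).elim _ _)
  obtain ⟨ψ, rfl⟩ := (Abelian.Ext.mk₀_bijective _ _).2 y
  rw [Abelian.Ext.mk₀_comp_mk₀] at hy
  have := (Abelian.Ext.mk₀_bijective _ _).1 hy
  exact ⟨ψ.hom, congrArg ModuleCat.Hom.hom this⟩

lemma ExtAcyclic.of_linearEquiv (e : A ≃ₗ[R] B) (hA : ExtAcyclic R A) : ExtAcyclic R B := by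
  refine ExtAcyclic.of_extension (f := e.toLinearMap) (g := (0 : B →ₗ[R] PUnit.{u+1}))
    e.injective ?_ (fun _ => ⟨0, Subsingleton.elim _ _⟩) hA ExtAcyclic.of_projective
  intro y
  simp

lemma dualMap_exact (hfg : Function.Exact f g) (hg : Function.Surjective g) :
    Function.Exact g.dualMap f.dualMap := by
  intro φ
  constructor
  · intro h
    have hk : LinearMap.ker g ≤ LinearMap.ker φ := by
      intro b hb
      obtain ⟨a, rfl⟩ := (hfg b).1 hb
      exact LinearMap.congr_fun h a
    refine ⟨((LinearMap.ker g).liftQ φ hk) ∘ₗ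
      (g.quotKerEquivOfSurjective hg).symm.toLinearMap, ?_⟩
    ext b
    have : (g.quotKerEquivOfSurjective hg).symm (g b) = Submodule.Quotient.mk b := by
      rw [LinearEquiv.symm_apply_eq]; rfl
    simp [this]
  · rintro ⟨ψ, rfl⟩
    ext a
    simp [hfg.apply_apply_eq_zero]

end ExtAcyclic

/-! ### Totally reflexive modules in short exact sequences. -/

section TotallyReflexive

variable {R : Type u} [CommRing R] [IsNoetherianRing R]
variable {A B C : Type u} [AddCommGroup A] [Module R A] [AddCommGroup B] [Module R B]
  [AddCommGroup C] [Module R C]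

lemma Module.Dual.finite_of_isNoetherianRing [Module.Finite R A] :
    Module.Finite R (Module.Dual R A) := by
  obtain ⟨n, π, hπ⟩ := Module.Finite.exists_fin' R A
  exact Module.Finite.of_injective π.dualMap (LinearMap.dualMap_injective_of_surjective hπ)

variable {f : A →ₗ[R] B} {g : B →ₗ[R] C}

omit [IsNoetherianRing R] in
lemma IsTotallyReflexive.of_free [Module.Free R A] [Module.Finite R A] :
    IsTotallyReflexive R A where
  finite := inferInstance
  reflexive := (Module.evalEquiv R A).bijective
  ext_eq_zero := ExtAcyclic.of_projective
  ext_dual_eq_zero := ExtAcyclic.of_projective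

omit [IsNoetherianRing R] in
lemma IsTotallyReflexive.of_linearEquiv (e : A ≃ₗ[R] B) (hA : IsTotallyReflexive R A) :
    IsTotallyReflexive R B where
  finite := have := hA.finite; Module.Finite.equiv e
  reflexive := by
    have h : Module.Dual.eval R B =
        (e.dualMap.dualMap.toLinearMap ∘ₗ Module.Dual.eval R A) ∘ₗ e.symm.toLinearMap := by
      ext; simp
    rw [h]
    exact (e.dualMap.dualMap.bijective.comp hA.reflexive).comp e.symm.bijective
  ext_eq_zero := ExtAcyclic.of_linearEquiv e hA.ext_eq_zero
  ext_dual_eq_zero := ExtAcyclic.of_linearEquiv e.dualMap.symm hA.ext_dual_eq_zero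

lemma IsTotallyReflexive.dual (hA : IsTotallyReflexive R A) :
    IsTotallyReflexive R (Module.Dual R A) where
  finite := have := hA.finite; Module.Dual.finite_of_isNoetherianRing
  reflexive := by
    let e := LinearEquiv.ofBijective _ hA.reflexive
    have h : Module.Dual.eval R (Module.Dual R A) = e.symm.dualMap.toLinearMap := by
      ext φ y
      obtain ⟨a, rfl⟩ := e.surjective y
      simp [e]
    rw [h]
    exact e.symm.dualMap.bijective
  ext_eq_zero := hA.ext_dual_eq_zero
  ext_dual_eq_zero :=
    ExtAcyclic.of_linearEquiv (LinearEquiv.ofBijective _ hA.reflexive) hA.ext_eq_zero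

omit [IsNoetherianRing R] in
-- Both the dual and the bidual sequence are exact, so bijectivity of evaluation on `B` follows by
-- the five lemma.
lemma IsTotallyReflexive.of_extension (hf : Function.Injective f) (hfg : Function.Exact f g)
    (hg : Function.Surjective g) (hA : IsTotallyReflexive R A) (hC : IsTotallyReflexive R C) :
    IsTotallyReflexive R B := by
  have := hA.finite
  have := hC.finite
  have hg' := LinearMap.dualMap_injective_of_surjective hg
  have hf' := ExtAcyclic.dualMap_surjective hf hfg hg hC.ext_eq_zero
  have he := dualMap_exact hfg hg
  have he' := dualMap_exact he hf'
  refine ⟨Module.Finite.of_exact hfg hg, ?_,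
    ExtAcyclic.of_extension hf hfg hg hA.ext_eq_zero hC.ext_eq_zero,
    ExtAcyclic.of_extension hg' he hf' hC.ext_dual_eq_zero hA.ext_dual_eq_zero⟩
  have hff := LinearMap.dualMap_injective_of_surjective hf'
  constructor
  · rw [injective_iff_map_eq_zero]
    intro b hb
    have h1 : g b = 0 := hC.reflexive.1 (by
      have := LinearMap.congr_fun (Module.Dual.eval_naturality g) b
      simp only [LinearMap.comp_apply, hb, map_zero] at this ⊢
      exact this.symm)
    obtain ⟨a, rfl⟩ := (hfg b).1 h1
    have h2 : f.dualMap.dualMap (Module.Dual.eval R A a) = 0 := by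
      rw [← hb]; exact LinearMap.congr_fun (Module.Dual.eval_naturality f) a
    rw [hA.reflexive.1 ((hff (h2.trans (map_zero _).symm)).trans (map_zero _).symm), map_zero]
  · intro y
    obtain ⟨c, hc⟩ := hC.reflexive.2 (g.dualMap.dualMap y)
    obtain ⟨b, rfl⟩ := hg c
    have : g.dualMap.dualMap (y - Module.Dual.eval R B b) = 0 := by
      rw [map_sub, ← hc, sub_eq_zero]
      exact (LinearMap.congr_fun (Module.Dual.eval_naturality g) b).symm
    obtain ⟨z, hz⟩ := (he' _).1 this
    obtain ⟨a, rfl⟩ := hA.reflexive.2 z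
    refine ⟨f a + b, ?_⟩
    rw [map_add, ← eq_sub_iff_add_eq, ← hz]
    exact (LinearMap.congr_fun (Module.Dual.eval_naturality f) a).symm

/-- `A*` is the cokernel of `C* → B*`. Its `Ext¹` vanishes because `B** → C**` is identified with
the surjection `g` by reflexivity. -/
lemma IsTotallyReflexive.of_kernel (hf : Function.Injective f) (hfg : Function.Exact f g)
    (hg : Function.Surjective g) (hB : IsTotallyReflexive R B) (hC : IsTotallyReflexive R C) :
    IsTotallyReflexive R A := by
  have := hB.finite
  have hg' := LinearMap.dualMap_injective_of_surjective hg
  have hf' := ExtAcyclic.dualMap_surjective hf hfg hg hC.ext_eq_zero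
  have he := dualMap_exact hfg hg
  have he' := dualMap_exact he hf'
  have hff := LinearMap.dualMap_injective_of_surjective hf'
  have hgg : Function.Surjective g.dualMap.dualMap := by
    intro y
    obtain ⟨c, rfl⟩ := hC.reflexive.2 y
    obtain ⟨b, rfl⟩ := hg c
    exact ⟨_, LinearMap.congr_fun (Module.Dual.eval_naturality g) b⟩
  refine ⟨Module.Finite.of_injective f hf, ⟨?_, ?_⟩,
    ExtAcyclic.of_kernel hf hfg hg hB.ext_eq_zero hC.ext_eq_zero,
    ExtAcyclic.of_cokernel hg' he hf' hC.ext_dual_eq_zero hB.ext_dual_eq_zero hgg⟩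
  · refine Function.Injective.of_comp (f := f.dualMap.dualMap) ?_
    rw [← LinearMap.coe_comp, Module.Dual.eval_naturality]
    exact hB.reflexive.1.comp hf
  · intro y
    obtain ⟨b, hb⟩ := hB.reflexive.2 (f.dualMap.dualMap y)
    have h1 : g b = 0 := hC.reflexive.1 (by
      have := LinearMap.congr_fun (Module.Dual.eval_naturality g) b
      simp only [LinearMap.comp_apply] at this
      rw [← this, hb, he'.apply_apply_eq_zero, map_zero])
    obtain ⟨a, rfl⟩ := (hfg b).1 h1
    refine ⟨a, hff ?_⟩
    rw [← hb]
    exact LinearMap.congr_fun (Module.Dual.eval_naturality f) a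

/-- A totally reflexive module embeds in a finite free module with totally reflexive cokernel. -/
lemma IsTotallyReflexive.exists_embedding_free (hA : IsTotallyReflexive R A) :
    ∃ (F C : Type u) (_ : AddCommGroup F) (_ : Module R F) (_ : AddCommGroup C) (_ : Module R C)
      (f : A →ₗ[R] F) (g : F →ₗ[R] C), Module.Free R F ∧ Module.Finite R F ∧
      Function.Injective f ∧ Function.Exact f g ∧ Function.Surjective g ∧
      IsTotallyReflexive R C := by
  have hA' := hA.dual
  have := hA'.finite
  -- Dualising a free cover of `A*` with kernel `K` gives `0 → A** → F* → K* → 0`, and `A**` is `A`.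
  obtain ⟨n, π, hπ⟩ := Module.Finite.exists_fin' R (Module.Dual R A)
  have hex := LinearMap.exact_subtype_ker_map π
  have hinj := (LinearMap.ker π).injective_subtype
  have hK : IsTotallyReflexive R (LinearMap.ker π) :=
    .of_kernel hinj hex hπ .of_free hA'
  refine ⟨Module.Dual R (Fin n → R), Module.Dual R (LinearMap.ker π), inferInstance,
    inferInstance, inferInstance, inferInstance, π.dualMap ∘ₗ Module.Dual.eval R A,
    (LinearMap.ker π).subtype.dualMap, inferInstance, inferInstance,
    (LinearMap.dualMap_injective_of_surjective hπ).comp hA.reflexive.1, ?_,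
    ExtAcyclic.dualMap_surjective hinj hex hπ hA'.ext_eq_zero, hK.dual⟩
  intro y
  rw [dualMap_exact hex hπ y]
  exact (hA.reflexive.2.range_comp π.dualMap ▸ Iff.rfl)

end TotallyReflexive

/-! ### Modules `N` with `Ext¹(G, N) = 0` for all totally reflexive `G`. -/

section TRLift

/-- `N` has the extension property along the inclusions `L → F` of totally reflexive modules into
finite free modules with totally reflexive cokernel. Equivalently, `Ext¹(G, N) = 0` for all totally
reflexive modules `G`. -/
def TRLift (R : Type u) [CommRing R] (N : Type u) [AddCommGroup N] [Module R N] : Prop :=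
  ∀ (L F G : Type u) [AddCommGroup L] [Module R L] [AddCommGroup F] [Module R F]
    [AddCommGroup G] [Module R G] (i : L →ₗ[R] F) (p : F →ₗ[R] G), Module.Free R F →
    Module.Finite R F → Function.Injective i → Function.Exact i p → Function.Surjective p →
    IsTotallyReflexive R L → IsTotallyReflexive R G →
    ∀ φ : L →ₗ[R] N, ∃ ψ : F →ₗ[R] N, ψ ∘ₗ i = φ

variable {R : Type u} [CommRing R]
variable {N X M : Type u} [AddCommGroup N] [Module R N] [AddCommGroup X] [Module R X]
  [AddCommGroup M] [Module R M]

lemma TRLift.of_subsingleton [Subsingleton N] : TRLift R N := by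
  intro L F G _ _ _ _ _ _ i p _ _ _ _ _ _ _ φ
  exact ⟨0, Subsingleton.elim _ _⟩

lemma TRLift.of_free [Module.Free R N] [Module.Finite R N] : TRLift R N := by
  intro L F G _ _ _ _ _ _ i p _ _ hi hip hp _ hG φ
  let b := Module.Free.chooseBasis R N
  choose ψ hψ using fun k => ExtAcyclic.dualMap_surjective hi hip hp hG.ext_eq_zero (b.coord k ∘ₗ φ)
  refine ⟨∑ k, (ψ k).smulRight (b k), ?_⟩
  ext l
  have h : ∀ k, ψ k (i l) = b.repr (φ l) k := fun k => LinearMap.congr_fun (hψ k) l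
  simp [h, b.sum_repr]

variable [IsNoetherianRing R]

/-- Lift over a free cover `p` of `G`. On `ker p` the lift takes values in `N`; extending that
restriction to the cover and subtracting it lets the lift descend to `G`. -/
lemma TRLift.exists_lift (hN : TRLift R N) {j : N →ₗ[R] X} {π : X →ₗ[R] M}
    (hj : Function.Injective j) (hjπ : Function.Exact j π) (hπ : Function.Surjective π)
    {G : Type u} [AddCommGroup G] [Module R G] (hG : IsTotallyReflexive R G) (φ : G →ₗ[R] M) :
    ∃ ψ : G →ₗ[R] X, π ∘ₗ ψ = φ := by
  have := hG.finite
  obtain ⟨n, p, hp⟩ := Module.Finite.exists_fin' R G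
  have hex := LinearMap.exact_subtype_ker_map p
  have hinj := (LinearMap.ker p).injective_subtype
  obtain ⟨h, hh⟩ := Module.projective_lifting_property π (φ ∘ₗ p) hπ
  have hr : ∀ l : LinearMap.ker p, (h ∘ₗ (LinearMap.ker p).subtype) l ∈ LinearMap.range j := by
    intro l
    refine (hjπ _).1 ?_
    have := LinearMap.congr_fun hh l
    simpa using this
  let e := LinearEquiv.ofInjective j hj
  obtain ⟨θ, hθ⟩ := hN _ _ _ (LinearMap.ker p).subtype p inferInstance inferInstance hinj hex hp
    (.of_kernel hinj hex hp .of_free hG) hG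
    (e.symm.toLinearMap ∘ₗ (h ∘ₗ (LinearMap.ker p).subtype).codRestrict _ hr)
  have hk : LinearMap.ker p ≤ LinearMap.ker (h - j ∘ₗ θ) := by
    intro x hx
    have h1 := LinearMap.congr_fun hθ ⟨x, hx⟩
    have h2 := congrArg (fun y => (e y : X)) h1
    simp only [LinearMap.comp_apply, LinearEquiv.coe_coe, LinearEquiv.apply_symm_apply] at h2
    have h3 : j (θ x) = h x := h2
    simp [h3]
  refine ⟨(LinearMap.ker p).liftQ _ hk ∘ₗ (p.quotKerEquivOfSurjective hp).symm.toLinearMap, ?_⟩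
  ext g
  obtain ⟨x, rfl⟩ := hp g
  have h1 : (p.quotKerEquivOfSurjective hp).symm (p x) = Submodule.Quotient.mk x := by
    rw [LinearEquiv.symm_apply_eq]; rfl
  have h2 : π (h x) = φ (p x) := LinearMap.congr_fun hh x
  simp [h1, h2, hjπ.apply_apply_eq_zero]

/-- A map `L → M` lifts to `X` because `L` is itself totally reflexive, and the lift then extends to
`F`. This is dimension shifting: `Ext²(G, N) = Ext¹(L, N) = 0`. -/
lemma TRLift.of_cokernel (hN : TRLift R N) (hX : TRLift R X) {j : N →ₗ[R] X} {π : X →ₗ[R] M}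
    (hj : Function.Injective j) (hjπ : Function.Exact j π) (hπ : Function.Surjective π) :
    TRLift R M := by
  intro L F G _ _ _ _ _ _ i p hF hF' hi hip hp hL hG φ
  obtain ⟨φ', rfl⟩ := hN.exists_lift hj hjπ hπ hL φ
  obtain ⟨ψ, rfl⟩ := hX L F G i p hF hF' hi hip hp hL hG φ'
  exact ⟨π ∘ₗ ψ, rfl⟩

end TRLift

/-! ### Splicing and truncating resolutions. -/

namespace GResolution

variable {R : Type u} [CommRing R]
variable {K X M : Type u} [AddCommGroup K] [Module R K] [AddCommGroup X] [Module R X]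
  [AddCommGroup M] [Module R M]

/-- The resolution `⋯ → T₁ → T₀ → X → M → 0` obtained from a resolution of the kernel of
`X → M`. -/
noncomputable def splice (T : GResolution R K) (hX : IsTotallyReflexive R X) {j : K →ₗ[R] X}
    {π : X →ₗ[R] M} (hj : Function.Injective j) (hjπ : Function.Exact j π)
    (hπ : Function.Surjective π) : GResolution R M where
  complex := T.complex.augment (X := ModuleCat.of R X) (T.ε ≫ ModuleCat.ofHom j) (by
    ext x
    simp [T.exact_zero.apply_apply_eq_zero])
  ε := ModuleCat.ofHom π
  totallyReflexive n := by
    cases n with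
    | zero => exact hX
    | succ n => exact T.totallyReflexive n
  exact_succ n := by
    cases n with
    | zero =>
      intro x
      refine Iff.trans ?_ (T.exact_zero x)
      change j (T.ε.hom x) = 0 ↔ _
      rw [← hj.eq_iff, map_zero]
    | succ n => exact T.exact_succ n
  exact_zero := by
    intro x
    refine (hjπ x).trans ?_
    exact (T.surjective.range_comp j ▸ Iff.rfl)
  surjective := hπ

/-- The resolution `⋯ → T₂ → T₁ → ker(T₀ → M) → 0`. -/
noncomputable def truncate (T : GResolution R M) : GResolution R (LinearMap.ker T.ε.hom) where
  complex := ChainComplex.truncate.obj T.complex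
  ε := ModuleCat.ofHom ((T.complex.d 1 0).hom.codRestrict _
    fun x => T.exact_zero.apply_apply_eq_zero x)
  totallyReflexive n := T.totallyReflexive (n + 1)
  exact_succ n := T.exact_succ (n + 1)
  exact_zero := by
    intro x
    refine Iff.trans ?_ (T.exact_succ 0 x)
    exact Subtype.ext_iff
  surjective := by
    rintro ⟨y, hy⟩
    obtain ⟨x, hx⟩ := (T.exact_zero y).1 hy
    exact ⟨x, Subtype.ext hx⟩

lemma HasLengthLE.splice {T : GResolution R K} {n : ℕ} (hT : T.HasLengthLE n)
    (hX : IsTotallyReflexive R X) {j : K →ₗ[R] X}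
    {π : X →ₗ[R] M} (hj : Function.Injective j) (hjπ : Function.Exact j π)
    (hπ : Function.Surjective π) : (T.splice hX hj hjπ hπ).HasLengthLE (n + 1) := by
  intro i hi
  obtain ⟨i, rfl⟩ := Nat.exists_eq_succ_of_ne_zero (by omega : i ≠ 0)
  exact hT i (by omega)

lemma HasLengthLE.truncate {T : GResolution R M} {n : ℕ} (hT : T.HasLengthLE (n + 1)) :
    T.truncate.HasLengthLE n :=
  fun i hi => hT (i + 1) (by omega)

lemma IsProper.splice {T : GResolution R K} (hT : T.IsProper)
    (hX : IsTotallyReflexive R X) {j : K →ₗ[R] X}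
    {π : X →ₗ[R] M} (hj : Function.Injective j) (hjπ : Function.Exact j π)
    (hπ : Function.Surjective π)
    (h : ∀ (G : Type u) [AddCommGroup G] [Module R G], IsTotallyReflexive R G →
      ∀ φ : G →ₗ[R] M, ∃ ψ : G →ₗ[R] X, π ∘ₗ ψ = φ) :
    (T.splice hX hj hjπ hπ).IsProper where
  exact_succ G _ _ hG n := by
    cases n with
    | zero =>
      intro φ
      refine Iff.trans ?_ (hT.exact_zero G hG φ)
      change (j ∘ₗ (T.ε.hom ∘ₗ φ) : G →ₗ[R] X) = 0 ↔ _
      constructor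
      · intro h
        ext g
        exact hj ((LinearMap.congr_fun h g).trans (map_zero j).symm)
      · intro h
        have h' : (T.ε.hom ∘ₗ φ : G →ₗ[R] K) = 0 := h
        ext g
        exact (congrArg j (LinearMap.congr_fun h' g)).trans (map_zero j)
    | succ n => exact hT.exact_succ G hG n
  exact_zero G _ _ hG := by
    intro (φ : G →ₗ[R] X)
    change π ∘ₗ φ = 0 ↔ _
    constructor
    · intro hφ
      have hr : ∀ g, φ g ∈ LinearMap.range j := fun g => (hjπ _).1 (LinearMap.congr_fun hφ g)
      let e := LinearEquiv.ofInjective j hj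
      obtain ⟨ψ, hψ⟩ := hT.surjective G hG (e.symm.toLinearMap ∘ₗ φ.codRestrict _ hr)
      refine ⟨ψ, ?_⟩
      change j ∘ₗ (T.ε.hom ∘ₗ ψ) = φ
      ext g
      have h1 := congrArg (fun y => (e y : X)) (LinearMap.congr_fun hψ g)
      simp only [LinearMap.comp_apply, LinearEquiv.coe_coe, LinearEquiv.apply_symm_apply] at h1
      exact h1
    · rintro ⟨ψ, rfl⟩
      ext g
      exact hjπ.apply_apply_eq_zero _
  surjective G _ _ hG := h G hG

/-- The resolution of the zero module by zero modules. -/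
noncomputable def ofSubsingleton (R : Type u) [CommRing R] (M : Type u) [AddCommGroup M]
    [Module R M] [Subsingleton M] : GResolution R M where
  complex :=
    { X := fun _ => ModuleCat.of R PUnit.{u + 1}
      d := fun _ _ => 0 }
  ε := 0
  totallyReflexive _ := IsTotallyReflexive.of_free (A := PUnit.{u + 1})
  exact_succ _ := fun _ => ⟨fun _ => ⟨0, rfl⟩, fun _ => rfl⟩
  exact_zero := fun _ => ⟨fun _ => ⟨0, rfl⟩, fun _ => rfl⟩
  surjective := fun x => ⟨0, Subsingleton.elim (α := M) _ x⟩

lemma ofSubsingleton_subsingleton [Subsingleton M] (i : ℕ) :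
    Subsingleton ((ofSubsingleton R M).complex.X i) :=
  inferInstanceAs (Subsingleton PUnit.{u + 1})

lemma IsProper.of_subsingleton {T : GResolution R M} [Subsingleton M]
    (h : ∀ i, Subsingleton (T.complex.X i)) : T.IsProper where
  exact_succ _ _ _ _ n := fun _ =>
    ⟨fun _ => ⟨0, have := h (n + 1); Subsingleton.elim _ _⟩,
      fun _ => have := h n; Subsingleton.elim _ _⟩
  exact_zero _ _ _ _ := fun _ =>
    ⟨fun _ => ⟨0, have := h 0; Subsingleton.elim _ _⟩, fun _ => Subsingleton.elim _ _⟩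
  surjective _ _ _ _ := fun _ => ⟨0, Subsingleton.elim _ _⟩

end GResolution

/-! ### Approximations and the existence of proper resolutions. -/

namespace GResolution

variable {R : Type u} [CommRing R]

/-- `K` has a proper resolution by finite free modules that vanish in degrees `≥ n`. -/
def ExistsFree (R : Type u) [CommRing R] (n : ℕ) (K : Type u) [AddCommGroup K] [Module R K] :
    Prop :=
  ∃ T : GResolution R K, T.IsProper ∧ (∀ i, Module.Free R (T.complex.X i)) ∧
    ∀ i, n ≤ i → Subsingleton (T.complex.X i)

variable {K X M : Type u} [AddCommGroup K] [Module R K] [AddCommGroup X] [Module R X]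
  [AddCommGroup M] [Module R M]

lemma ExistsFree.of_subsingleton [Subsingleton K] : ExistsFree R 0 K :=
  ⟨ofSubsingleton R K, .of_subsingleton ofSubsingleton_subsingleton,
    fun _ => inferInstanceAs (Module.Free R PUnit.{u + 1}),
    fun i _ => ofSubsingleton_subsingleton i⟩

lemma ExistsFree.splice [IsNoetherianRing R] {n : ℕ} (hK : ExistsFree R n K) (hK' : TRLift R K)
    [Module.Free R X] [Module.Finite R X] {j : K →ₗ[R] X} {π : X →ₗ[R] M}
    (hj : Function.Injective j) (hjπ : Function.Exact j π) (hπ : Function.Surjective π) :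
    ExistsFree R (n + 1) M := by
  obtain ⟨T, hT, hT', hn⟩ := hK
  refine ⟨T.splice .of_free hj hjπ hπ, hT.splice .of_free hj hjπ hπ
    fun G _ _ hG φ => hK'.exists_lift hj hjπ hπ hG φ, ?_, ?_⟩
  · rintro (_ | i)
    · exact inferInstanceAs (Module.Free R X)
    · exact hT' i
  · rintro (_ | i) hi
    · omega
    · exact hn i (by omega)

lemma bijective_ε_of_hasLengthLE_zero {T : GResolution R M} (hT : T.HasLengthLE 0) :
    Function.Bijective T.ε.hom := by
  refine ⟨?_, T.surjective⟩
  rw [injective_iff_map_eq_zero]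
  intro x hx
  obtain ⟨y, rfl⟩ := (T.exact_zero x).1 hx
  have := hT 1 one_pos
  rw [Subsingleton.elim y 0, map_zero]

/-- The Auslander–Buchweitz approximation of a module of finite Gorenstein dimension. -/
theorem exists_approximation [IsNoetherianRing R] {n : ℕ} (T : GResolution R M)
    (hT : T.HasLengthLE n) :
    ∃ (K X : Type u) (_ : AddCommGroup K) (_ : Module R K) (_ : AddCommGroup X) (_ : Module R X)
      (j : K →ₗ[R] X) (π : X →ₗ[R] M), Function.Injective j ∧ Function.Exact j π ∧
      Function.Surjective π ∧ IsTotallyReflexive R X ∧ TRLift R K ∧ ExistsFree R n K := by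
  induction n generalizing M with
  | zero =>
    refine ⟨PUnit, M, inferInstance, inferInstance, inferInstance, inferInstance, 0,
      LinearMap.id, fun _ _ _ => rfl, fun x => ?_, Function.surjective_id,
      (T.totallyReflexive 0).of_linearEquiv
        (LinearEquiv.ofBijective _ (bijective_ε_of_hasLengthLE_zero hT)),
      .of_subsingleton, .of_subsingleton⟩
    simp [eq_comm]
  | succ n ih =>
    -- Approximate the first syzygy by `X`, embed `X` in a free `F` with totally reflexive cokernel
    -- `C`, and let `Y` be the pushout of `T₀ ← X → F`. Then `0 → T₀ → Y → C → 0` makes `Y` totally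
    -- reflexive, and `0 → F/K → Y → M → 0` is the new approximation.
    obtain ⟨K, X, _, _, _, _, j, π, hj, hjπ, hπ, hX, hK, hn⟩ := ih T.truncate hT.truncate
    obtain ⟨F, C, _, _, _, _, f, g, _, _, hf, hfg, hg, hC⟩ := hX.exists_embedding_free
    let p : T.complex.X 0 →ₗ[R] M := T.ε.hom
    let q₁ : X →ₗ[R] T.complex.X 0 := (LinearMap.ker p).subtype ∘ₗ π
    have hp : ∀ x, p (q₁ x) = 0 := fun x => (π x).2
    have hq₁ : ∀ x, q₁ x = 0 → ∃ k, j k = x := fun x hx => (hjπ x).1 (Subtype.ext hx)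
    have hq₁j : ∀ k, q₁ (j k) = 0 := fun k =>
      congrArg Subtype.val (hjπ.apply_apply_eq_zero k)
    have hq₁p : ∀ a, p a = 0 → ∃ x, q₁ x = a := fun a ha => by
      obtain ⟨x, hx⟩ := hπ ⟨a, ha⟩
      exact ⟨x, congrArg Subtype.val hx⟩
    let q : X →ₗ[R] T.complex.X 0 × F := q₁.prod (-f)
    have hq : ∀ x, q x = (q₁ x, -f x) := fun x => rfl
    let P := LinearMap.range q
    let Y := (T.complex.X 0 × F) ⧸ P
    let inl : T.complex.X 0 →ₗ[R] Y := P.mkQ ∘ₗ LinearMap.inl R _ _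
    let toC : Y →ₗ[R] C := P.liftQ (g ∘ₗ LinearMap.snd R _ _) (by
      rintro _ ⟨x, rfl⟩
      simp [hq, hfg.apply_apply_eq_zero])
    let toM : Y →ₗ[R] M := P.liftQ (p ∘ₗ LinearMap.fst R _ _) (by
      rintro _ ⟨x, rfl⟩
      simp [hq, hp])
    have hY : IsTotallyReflexive R Y := by
      refine .of_extension (f := inl) (g := toC) ?_ ?_ ?_ (T.totallyReflexive 0) hC
      · rw [injective_iff_map_eq_zero]
        intro a ha
        obtain ⟨x, hx⟩ := (Submodule.Quotient.mk_eq_zero P).1 ha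
        rw [hq, LinearMap.inl_apply, Prod.mk.injEq, neg_eq_zero] at hx
        rw [← hx.1, hf (hx.2.trans (map_zero f).symm), map_zero]
      · intro y
        obtain ⟨⟨a, y⟩, rfl⟩ := P.mkQ_surjective y
        constructor
        · intro h
          obtain ⟨x, rfl⟩ := (hfg y).1 h
          refine ⟨a + q₁ x, (Submodule.Quotient.eq P).2 ⟨x, ?_⟩⟩
          simp [hq]
        · rintro ⟨b, hb⟩
          rw [← hb]
          exact map_zero g
      · intro c
        obtain ⟨y, rfl⟩ := hg c
        exact ⟨P.mkQ (0, y), rfl⟩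
    let S := LinearMap.range (f ∘ₗ j)
    let inr : F ⧸ S →ₗ[R] Y := S.liftQ (P.mkQ ∘ₗ LinearMap.inr R _ _) (by
      rintro _ ⟨k, rfl⟩
      refine (Submodule.Quotient.mk_eq_zero P).2 ⟨-j k, ?_⟩
      simp [hq, hq₁j])
    have hfj : Function.Injective (f ∘ₗ j) := hf.comp hj
    have hex : Function.Exact (f ∘ₗ j) S.mkQ := (f ∘ₗ j).exact_map_mkQ_range
    refine ⟨F ⧸ S, Y, inferInstance, inferInstance, inferInstance, inferInstance, inr, toM,
      ?_, ?_, ?_, hY, hK.of_cokernel .of_free hfj hex S.mkQ_surjective,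
      hn.splice hK hfj hex S.mkQ_surjective⟩
    · rw [injective_iff_map_eq_zero]
      intro y hy
      obtain ⟨y, rfl⟩ := S.mkQ_surjective y
      obtain ⟨x, hx⟩ := (Submodule.Quotient.mk_eq_zero P).1 hy
      rw [hq, LinearMap.inr_apply, Prod.mk.injEq] at hx
      obtain ⟨k, rfl⟩ := hq₁ x hx.1
      exact (Submodule.Quotient.mk_eq_zero S).2 ⟨-k, by simpa using hx.2⟩
    · intro y
      obtain ⟨⟨a, y⟩, rfl⟩ := P.mkQ_surjective y
      constructor
      · intro h
        obtain ⟨x, rfl⟩ := hq₁p a h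
        refine ⟨S.mkQ (y + f x), (Submodule.Quotient.eq P).2 ⟨-x, ?_⟩⟩
        simp [hq]
      · rintro ⟨b, hb⟩
        rw [← hb]
        obtain ⟨b, rfl⟩ := S.mkQ_surjective b
        exact map_zero p
    · intro m
      obtain ⟨a, rfl⟩ := T.surjective m
      exact ⟨P.mkQ (a, 0), rfl⟩

/-- A module of Gorenstein dimension at most `n` has a proper resolution of length at most `n`
that is free in positive degrees. -/
theorem exists_isProper_of_hasLengthLE [IsNoetherianRing R] {n : ℕ} (T : GResolution R M)
    (hT : T.HasLengthLE n) :
    ∃ T' : GResolution R M, T'.IsProper ∧ T'.HasLengthLE n ∧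
      ∀ i, Module.Free R (T'.complex.X (i + 1)) := by
  obtain ⟨K, X, _, _, _, _, j, π, hj, hjπ, hπ, hX, hK, T', hT', hfree, hn⟩ :=
    T.exists_approximation hT
  refine ⟨T'.splice hX hj hjπ hπ, hT'.splice hX hj hjπ hπ
    fun G _ _ hG φ => hK.exists_lift hj hjπ hπ hG φ, ?_, hfree⟩
  -- The resolution of `K` vanishes already in degree `n`, so the shift by one leaves length at most
  -- `n`.
  rintro (_ | i) hi
  · omega
  · exact hn i (by omega)

/-- If the cokernel of `T_{n+1} → T_n` is totally reflexive, then `M` has a resolution of length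
at most `n`. -/
theorem exists_hasLengthLE_of_cokernel {n : ℕ} (T : GResolution R M)
    (hT : IsTotallyReflexive R
      (T.complex.X n ⧸ LinearMap.range (T.complex.d (n + 1) n).hom)) :
    ∃ T' : GResolution R M, T'.HasLengthLE n := by
  induction n generalizing M with
  | zero =>
    -- The cokernel of `T₁ → T₀` is `M`, which is then its own resolution.
    have e := (Submodule.quotEquivOfEq _ _ T.exact_zero.linearMap_ker_eq.symm).trans
      (T.ε.hom.quotKerEquivOfSurjective T.surjective)
    have hM : IsTotallyReflexive R M := hT.of_linearEquiv e
    refine ⟨(ofSubsingleton R PUnit.{u + 1}).splice hM (j := 0) (π := LinearMap.id)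
      (fun _ _ _ => rfl) (fun x => by simp [eq_comm]) Function.surjective_id, ?_⟩
    rintro (_ | i) hi
    · omega
    · exact ofSubsingleton_subsingleton (M := PUnit.{u + 1}) i
  | succ n ih =>
    obtain ⟨T', hT'⟩ := ih T.truncate hT
    exact ⟨_, hT'.splice (T.totallyReflexive 0) (LinearMap.ker T.ε.hom).injective_subtype
      (LinearMap.exact_subtype_ker_map _) T.surjective⟩

end GResolution

/-- The infimum is attained: if no resolution has length at most `r`, all admissible lengths are at
least `r + 1`. -/
lemma gDim_le_iff {R : Type u} [CommRing R] {M : Type u} [AddCommGroup M] [Module R M] (r : ℕ) :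
    gDim R M ≤ (r : ℕ∞) ↔ ∃ T : GResolution R M, T.HasLengthLE r := by
  constructor
  · intro h
    by_contra hc
    have h1 : ((r + 1 : ℕ) : ℕ∞) ≤ gDim R M := by
      refine le_iInf₂ fun n hn => ?_
      obtain ⟨T, hT⟩ := hn
      by_contra hlt
      rw [Nat.cast_le] at hlt
      exact hc ⟨T, fun i hi => hT i (by omega)⟩
    have h2 := h1.trans h
    rw [Nat.cast_le] at h2
    omega
  · intro h
    exact iInf₂_le r h

/-! ### Comparison of proper resolutions. -/

namespace GResolution

variable {R : Type u} [CommRing R] {M : Type u} [AddCommGroup M] [Module R M]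

lemma d_comp_ε (T : GResolution R M) : T.complex.d 1 0 ≫ T.ε = 0 := by
  ext x
  exact T.exact_zero.apply_apply_eq_zero x

namespace IsProper

variable {T : GResolution R M} {G : ModuleCat.{u} R}

lemma exists_lift_succ (hT : T.IsProper) (hG : IsTotallyReflexive R G) {n : ℕ}
    (f : G ⟶ T.complex.X (n + 1)) (hf : f ≫ T.complex.d (n + 1) n = 0) :
    ∃ h : G ⟶ T.complex.X (n + 2), h ≫ T.complex.d (n + 2) (n + 1) = f := by
  obtain ⟨h, hh⟩ := (hT.exact_succ G hG n f.hom).1 (congrArg ModuleCat.Hom.hom hf)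
  exact ⟨ModuleCat.ofHom h, ModuleCat.hom_ext hh⟩

lemma exists_lift_zero (hT : T.IsProper) (hG : IsTotallyReflexive R G)
    (f : G ⟶ T.complex.X 0) (hf : f ≫ T.ε = 0) :
    ∃ h : G ⟶ T.complex.X 1, h ≫ T.complex.d 1 0 = f := by
  obtain ⟨h, hh⟩ := (hT.exact_zero G hG f.hom).1 (congrArg ModuleCat.Hom.hom hf)
  exact ⟨ModuleCat.ofHom h, ModuleCat.hom_ext hh⟩

lemma exists_lift (hT : T.IsProper) (hG : IsTotallyReflexive R G) (f : G ⟶ ModuleCat.of R M) :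
    ∃ h : G ⟶ T.complex.X 0, h ≫ T.ε = f := by
  obtain ⟨h, hh⟩ := hT.surjective G hG f.hom
  exact ⟨ModuleCat.ofHom h, ModuleCat.hom_ext hh⟩

/-- Any resolution by totally reflexive modules maps to a proper one over the identity. -/
lemma exists_hom (hT : T.IsProper) (S : GResolution R M) :
    ∃ f : S.complex ⟶ T.complex, f.f 0 ≫ T.ε = S.ε := by
  obtain ⟨f₀, h₀⟩ := hT.exists_lift (S.totallyReflexive 0) S.ε
  obtain ⟨f₁, h₁⟩ := hT.exists_lift_zero (S.totallyReflexive 1) (S.complex.d 1 0 ≫ f₀)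
    (by rw [Category.assoc, h₀, S.d_comp_ε])
  -- Two consecutive components with their commutation relation form the input that
  -- `ChainComplex.mkHom` expects.
  have h₂ : ∀ (n : ℕ) (p : Σ' (f : S.complex.X n ⟶ T.complex.X n)
      (f' : S.complex.X (n + 1) ⟶ T.complex.X (n + 1)),
        f' ≫ T.complex.d (n + 1) n = S.complex.d (n + 1) n ≫ f),
      ∃ f'' : S.complex.X (n + 2) ⟶ T.complex.X (n + 2),
        f'' ≫ T.complex.d (n + 2) (n + 1) = S.complex.d (n + 2) (n + 1) ≫ p.2.1 := fun n p =>
    hT.exists_lift_succ (S.totallyReflexive _) _ (by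
      rw [Category.assoc, p.2.2, HomologicalComplex.d_comp_d_assoc, Limits.zero_comp])
  exact ⟨ChainComplex.mkHom _ _ f₀ f₁ h₁ fun n p => ⟨(h₂ n p).choose, (h₂ n p).choose_spec⟩,
    by simpa using h₀⟩

/-- A map to a proper resolution that lifts the zero map is null-homotopic. -/
lemma nonempty_homotopy_zero (hT : T.IsProper) {S : GResolution R M}
    (e : S.complex ⟶ T.complex) (he : e.f 0 ≫ T.ε = 0) : Nonempty (Homotopy e 0) := by
  obtain ⟨h₀, hh₀⟩ := hT.exists_lift_zero (S.totallyReflexive 0) (e.f 0) he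
  obtain ⟨h₁, hh₁⟩ := hT.exists_lift_succ (S.totallyReflexive 1)
    (e.f 1 - S.complex.d 1 0 ≫ h₀) (by simp [hh₀])
  have h₂ : ∀ (n : ℕ) (p : Σ' (f : S.complex.X n ⟶ T.complex.X (n + 1))
      (f' : S.complex.X (n + 1) ⟶ T.complex.X (n + 2)),
        e.f (n + 1) = S.complex.d (n + 1) n ≫ f + f' ≫ T.complex.d (n + 2) (n + 1)),
      ∃ f'' : S.complex.X (n + 2) ⟶ T.complex.X (n + 3),
        f'' ≫ T.complex.d (n + 3) (n + 2) =
          e.f (n + 2) - S.complex.d (n + 2) (n + 1) ≫ p.2.1 := fun n p =>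
    hT.exists_lift_succ (S.totallyReflexive _) _ (by
      have := p.2.2
      rw [← sub_eq_iff_eq_add'] at this
      simp [← this])
  exact ⟨Homotopy.mkInductive e h₀ hh₀.symm h₁ (by rw [hh₁]; abel)
    fun n p => ⟨(h₂ n p).choose, by rw [(h₂ n p).choose_spec]; abel⟩⟩

/-- Vanishing of the relative homology does not depend on the proper resolution. -/
theorem subsingleton_gTor (hT : T.IsProper) {T' : GResolution R M} (hT' : T'.IsProper)
    (N : Type u) [AddCommGroup N] [Module R N] (i : ℕ) (h : Subsingleton (T'.gTor N i)) :
    Subsingleton (T.gTor N i) := by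
  obtain ⟨f, hf⟩ := hT'.exists_hom T
  obtain ⟨g, hg⟩ := hT.exists_hom T'
  -- One homotopy suffices: on homology the identity of `T ⊗ N` factors through that of `T' ⊗ N`,
  -- which is zero.
  obtain ⟨H⟩ := hT.nonempty_homotopy_zero (f ≫ g - 𝟙 T.complex) (by simp [hf, hg])
  let F := (MonoidalCategory.tensorRight (ModuleCat.of R N)).mapHomologicalComplex
    (ComplexShape.down ℕ)
  have H' : Homotopy (F.map (f ≫ g)) (F.map (𝟙 T.complex)) :=
    Functor.mapHomotopy _ (Homotopy.equivSubZero.symm H)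
  have hF := H'.homologyMap_eq i
  rw [F.map_id, HomologicalComplex.homologyMap_id, F.map_comp,
    HomologicalComplex.homologyMap_comp] at hF
  have hz : Limits.IsZero ((F.obj T'.complex).homology i) := ModuleCat.isZero_iff_subsingleton.2 h
  have hz' : Limits.IsZero ((F.obj T.complex).homology i) := by
    rw [Limits.IsZero.iff_id_eq_zero, ← hF,
      hz.eq_of_tgt (HomologicalComplex.homologyMap (F.map f) i) 0, Limits.zero_comp]
  exact ModuleCat.isZero_iff_subsingleton.1 hz'

end IsProper

/-! ### Relative homology and the length of a resolution. -/

lemma HasLengthLE.subsingleton_gTor {T : GResolution R M} {n : ℕ} (hT : T.HasLengthLE n)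
    (N : Type u) [AddCommGroup N] [Module R N] {i : ℕ} (hi : n < i) :
    Subsingleton (T.gTor N i) := by
  refine ModuleCat.isZero_iff_subsingleton.1 (ShortComplex.isZero_homology_of_isZero_X₂ _ ?_)
  exact (MonoidalCategory.tensorRight (ModuleCat.of R N)).map_isZero
    (ModuleCat.isZero_iff_subsingleton.2 (hT i hi))

lemma exact_rTensor_of_subsingleton_gTor (T : GResolution R M)
    (N : Type u) [AddCommGroup N] [Module R N] (i : ℕ) (h : Subsingleton (T.gTor N (i + 1))) :
    Function.Exact ((T.complex.d (i + 2) (i + 1)).hom.rTensor N)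
      ((T.complex.d (i + 1) i).hom.rTensor N) := by
  let C := ((MonoidalCategory.tensorRight (ModuleCat.of R N)).mapHomologicalComplex
    (ComplexShape.down ℕ)).obj T.complex
  have h1 : C.ExactAt (i + 1) := by
    rw [HomologicalComplex.exactAt_iff_isZero_homology]
    exact ModuleCat.isZero_iff_subsingleton.2 h
  rw [HomologicalComplex.exactAt_iff' C (i + 2) (i + 1) i (by simp) (by simp)] at h1
  exact (ShortComplex.ShortExact.moduleCat_exact_iff_function_exact _).1 h1

/-- Let `B` be the image of `T_{r+1} → T_r`. Exactness of `T ⊗ k` in degree `r + 1` makes `B ⊗ k →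
T_r ⊗ k` injective; since `T_r` is free, this forces `T_r / B` to be free. -/
theorem exists_hasLengthLE_of_subsingleton_gTor [IsLocalRing R] {T : GResolution R M} (r : ℕ)
    (hr : Module.Free R (T.complex.X r))
    (h : Subsingleton (T.gTor (IsLocalRing.ResidueField R) (r + 1))) :
    ∃ T' : GResolution R M, T'.HasLengthLE r := by
  have hfin : ∀ n, Module.Finite R (T.complex.X n) := fun n => (T.totallyReflexive n).finite
  have := hfin r
  have := hfin (r + 1)
  let d := (T.complex.d (r + 1) r).hom
  let d' := (T.complex.d (r + 2) (r + 1)).hom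
  let k := IsLocalRing.ResidueField R
  have hex : Function.Exact (d'.rTensor k) (d.rTensor k) :=
    T.exact_rTensor_of_subsingleton_gTor k r h
  have hinj : Function.Injective ((LinearMap.range d).subtype.lTensor k) := by
    rw [LinearMap.lTensor_inj_iff_rTensor_inj, injective_iff_map_eq_zero]
    intro x hx
    have hs : Function.Surjective (d.rangeRestrict.rTensor k) :=
      LinearMap.rTensor_surjective k d.surjective_rangeRestrict
    obtain ⟨y, rfl⟩ := hs x
    -- A lift `y` to `T_{r+1} ⊗ k` is a cycle, hence comes from `T_{r+2} ⊗ k`, and so already dies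
    -- in `B ⊗ k`.
    rw [← LinearMap.comp_apply, ← LinearMap.rTensor_comp, LinearMap.subtype_comp_codRestrict] at hx
    obtain ⟨z, rfl⟩ := (hex y).1 hx
    rw [← LinearMap.comp_apply, ← LinearMap.rTensor_comp]
    have : d.rangeRestrict ∘ₗ d' = 0 := by
      ext w
      exact (T.exact_succ r).apply_apply_eq_zero w
    rw [this, LinearMap.rTensor_zero, LinearMap.zero_apply]
  have : Module.Free R (T.complex.X r ⧸ LinearMap.range d) :=
    Module.free_of_lTensor_residueField_injective (LinearMap.range d).subtype
      (LinearMap.range d).mkQ (Submodule.mkQ_surjective _)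
      (LinearMap.exact_subtype_mkQ _) hinj
  exact T.exists_hasLengthLE_of_cokernel .of_free

end GResolution

/-! ### The equivalences. -/

theorem proposition1p5 (R : Type u) [CommRing R] [IsLocalRing R] [IsNoetherianRing R]
    (M : Type u) [AddCommGroup M] [Module R M] [Module.Finite R M] (hM : gDim R M ≠ ⊤) :
    (∃ T : GResolution R M, T.IsProper) ∧
    ∀ T : GResolution R M, T.IsProper → ∀ r : ℕ, 1 ≤ r →
      List.TFAE [
        gDim R M ≤ (r : ℕ∞),
        ∀ (N : Type u) [AddCommGroup N] [Module R N] [Module.Finite R N],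
          ∀ i : ℕ, r + 1 ≤ i → Subsingleton (T.gTor N i),
        ∀ (N : Type u) [AddCommGroup N] [Module R N] [Module.Finite R N],
          Subsingleton (T.gTor N (r + 1)),
        Subsingleton (T.gTor (IsLocalRing.ResidueField R) (r + 1))] := by
  obtain ⟨n, hn⟩ := ENat.ne_top_iff_exists.1 hM
  obtain ⟨S, hS⟩ := (gDim_le_iff n).1 hn.ge
  obtain ⟨P, hP, -, hPfree⟩ := S.exists_isProper_of_hasLengthLE hS
  refine ⟨⟨P, hP⟩, fun T hT r hr => ?_⟩
  tfae_have 1 → 2 := by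
    intro h N _ _ _ i hi
    obtain ⟨S, hS⟩ := (gDim_le_iff r).1 h
    obtain ⟨Q, hQ, hQr, -⟩ := S.exists_isProper_of_hasLengthLE hS
    exact hT.subsingleton_gTor hQ N i (hQr.subsingleton_gTor N hi)
  tfae_have 2 → 3 := fun h N _ _ _ => h N (r + 1) le_rfl
  tfae_have 3 → 4 := fun h => h (IsLocalRing.ResidueField R)
  tfae_have 4 → 1 := by
    intro h
    -- Positivity of `r` enters here: `P` is known to be free only in positive degrees.
    obtain ⟨r, rfl⟩ := Nat.exists_eq_succ_of_ne_zero (by omega : r ≠ 0)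
    exact (gDim_le_iff _).2 (GResolution.exists_hasLengthLE_of_subsingleton_gTor (r + 1)
      (hPfree r) (hP.subsingleton_gTor hT _ _ h))
  tfae_finish
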